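/- **Proposition 2.1.** Let $\mathbb{D}$ be the open unit disc in $\mathbb{C}$, and let $H^2$ be the Hilbert space of all analytic functions $f$ on $\mathbb{D}$ with $$\|f\|^2=\lim_{r\to1^-}\frac1{2\pi}\int_0^{2\pi}|f(re^{i\theta})|^2\,d\theta<\infty .$$ Let $J:H^2\to H^2$ be the conjugation $(Jf)(z)=\overline{f(\overline z)}$. A bounded operator $T$ on $H^2$ is called unitary if $T^*T=TT^*=I$, and $J$-symmetric if $JT^*J=T$. Let $\psi:\mathbb{D}\to\mathbb{C}$ and $\varphi:\mathbb{D}\to\mathbb{D}$ be analytic, and let $C_{\psi,\varphi}$ be the weighted composition operator $(C_{\psi,\varphi}f)(z)=\psi(z)f(\varphi(z))$. Then $C_{\psi,\varphi}$ is a bounded operator on $H^2$ that is unitary and $J$-symmetric if and only if one of the following holds: 1. there are $p\in\mathbb{D}\setminus\{0\}$ and $c\in\mathbb{C}$ with $|c|=1$ such that, for all $z\in\mathbb{D}$, $$\psi(z)=c\,\frac{(1-|p|^2)^{1/2}}{1-\overline p z}\qquad\text{and}\qquad \varphi(z)=\frac{\overline p}{p}\cdot\frac{p-z}{1-\overline p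 z};$$ 2. there are $\mu,\lambda\in\mathbb{C}$ with $|\mu|=|\lambda|=1$ such that $\psi(z)=\mu$ and $\varphi(z)=\lambda z$ for all $z\in\mathbb{D}$. -/

import Mathlib

open Complex Metric Filter Topology ComplexConjugate

noncomputable section

/-! ### Power series on the unit disc and integral means -/

/-- `f` is given on the open unit disc by the power series with coefficients `a`. -/
def HasDiscSeries (f : ℂ → ℂ) (a : ℕ → ℂ) : Prop :=
  ∀ z ∈ ball (0 : ℂ) 1, HasSum (fun n => a n * z ^ n) (f z)

namespace HasDiscSeries

lemma of_differentiableOn {f : ℂ → ℂ} (hf : DifferentiableOn ℂ f (ball 0 1)) :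
    HasDiscSeries f (fun n => (n.factorial : ℂ)⁻¹ * iteratedDeriv n f 0) := by
  intro z hz
  have h := Complex.hasSum_taylorSeries_on_ball hf hz
  refine h.congr_fun ?_
  intro n
  simp only [sub_zero, smul_eq_mul]
  ring

lemma summable_norm {f : ℂ → ℂ} {a : ℕ → ℂ} (h : HasDiscSeries f a) {r : ℝ} (h0 : 0 ≤ r)
    (h1 : r < 1) : Summable (fun n => ‖a n‖ * r ^ n) := by
  have hz : (r : ℂ) ∈ ball (0 : ℂ) 1 := by
    simpa [abs_of_nonneg h0] using h1
  have := (h _ hz).summable.norm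
  simpa [abs_of_nonneg h0] using this

lemma differentiableOn {f : ℂ → ℂ} {a : ℕ → ℂ} (h : HasDiscSeries f a) :
    DifferentiableOn ℂ f (ball 0 1) := by
  intro z hz
  have hz' : ‖z‖ < 1 := by simpa using hz
  obtain ⟨r, hr1, hr2⟩ := exists_between hz'
  have hr0 : 0 ≤ r := (norm_nonneg z).trans hr1.le
  have hd : DifferentiableOn ℂ (fun w => ∑' n, a n * w ^ n) (ball 0 r) := by
    refine differentiableOn_tsum_of_summable_norm (h.summable_norm hr0 hr2) (fun n => ?_)
      isOpen_ball (fun n w hw => ?_)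
    · fun_prop
    · have hw' : ‖w‖ ≤ r := by simpa using (mem_ball_zero_iff.1 hw).le
      rw [norm_mul, norm_pow]
      gcongr
  have hnhds : ball (0 : ℂ) r ∈ 𝓝 z := isOpen_ball.mem_nhds (by simpa using hr1)
  refine DifferentiableAt.differentiableWithinAt ?_
  refine (hd.differentiableAt hnhds).congr_of_eventuallyEq ?_
  filter_upwards [hnhds] with w hw
  exact (h w (ball_subset_ball hr2.le hw)).tsum_eq.symm

lemma circleMap_mem {r : ℝ} (h0 : 0 ≤ r) (h1 : r < 1) (θ : ℝ) :
    circleMap 0 r θ ∈ ball (0 : ℂ) 1 := by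
  simpa [abs_of_nonneg h0] using h1

lemma continuous_circle {f : ℂ → ℂ} {a : ℕ → ℂ} (h : HasDiscSeries f a) {r : ℝ} (h0 : 0 ≤ r)
    (h1 : r < 1) : Continuous (fun θ => f (circleMap 0 r θ)) :=
  h.differentiableOn.continuousOn.comp_continuous (continuous_circleMap 0 r)
    (fun θ => circleMap_mem h0 h1 θ)

lemma norm_le {f : ℂ → ℂ} {a : ℕ → ℂ} (h : HasDiscSeries f a) {r : ℝ} (h0 : 0 ≤ r)
    (h1 : r < 1) (θ : ℝ) : ‖f (circleMap 0 r θ)‖ ≤ ∑' n, ‖a n‖ * r ^ n := by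
  rw [← (h _ (circleMap_mem h0 h1 θ)).tsum_eq]
  refine tsum_of_norm_bounded (h.summable_norm h0 h1).hasSum (fun n => ?_)
  simp [abs_of_nonneg h0]

lemma integral_monomials (r : ℝ) (k n : ℕ) :
    ∫ θ in (0 : ℝ)..2 * Real.pi, circleMap 0 r θ ^ k * conj (circleMap 0 r θ ^ n) =
      if k = n then 2 * Real.pi * (r : ℂ) ^ (2 * n) else 0 := by
  have hcongr : ∀ θ : ℝ, circleMap 0 r θ ^ k * conj (circleMap 0 r θ ^ n) =
      (r : ℂ) ^ (k + n) * Complex.exp ((((k : ℂ) - n) * I) * θ) := by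
    intro θ
    have : ((((k : ℂ) - n) * I) * θ) = k * (θ * I) + n * (-(θ * I)) := by ring
    rw [this, Complex.exp_add, Complex.exp_nat_mul, Complex.exp_nat_mul]
    simp only [circleMap, zero_add, map_pow, map_mul, conj_ofReal, ← Complex.exp_conj, conj_I,
      mul_neg]
    ring
  simp_rw [hcongr]
  rw [intervalIntegral.integral_const_mul]
  split_ifs with hkn
  · subst hkn
    simp
    ring
  · have hne : ((k : ℂ) - n) * I ≠ 0 :=
      mul_ne_zero (sub_ne_zero.2 (by exact_mod_cast hkn)) I_ne_zero
    rw [integral_exp_mul_complex hne]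
    have : ((k : ℂ) - n) * I * ((2 * Real.pi : ℝ) : ℂ) =
        ((k - n : ℤ) : ℂ) * (2 * Real.pi * I) := by push_cast; ring
    rw [this, Complex.exp_int_mul_two_pi_mul_I]
    simp

lemma integral_mul_monomial {g : ℂ → ℂ} {b : ℕ → ℂ} (h : HasDiscSeries g b) {r : ℝ}
    (h0 : 0 ≤ r) (h1 : r < 1) (n : ℕ) :
    ∫ θ in (0 : ℝ)..2 * Real.pi, g (circleMap 0 r θ) * conj (circleMap 0 r θ ^ n) =
      2 * Real.pi * (b n * (r : ℂ) ^ (2 * n)) := by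
  have key := intervalIntegral.hasSum_integral_of_dominated_convergence
    (μ := MeasureTheory.volume) (a := 0) (b := 2 * Real.pi)
    (F := fun k θ => b k * (circleMap 0 r θ ^ k * conj (circleMap 0 r θ ^ n)))
    (f := fun θ => g (circleMap 0 r θ) * conj (circleMap 0 r θ ^ n))
    (fun k _ => ‖b k‖ * r ^ k * r ^ n) ?_ ?_ ?_ ?_ ?_
  · rw [← key.tsum_eq, tsum_eq_single n]
    · rw [intervalIntegral.integral_const_mul, integral_monomials, if_pos rfl]
      ring
    · intro k hk
      rw [intervalIntegral.integral_const_mul, integral_monomials, if_neg hk, mul_zero]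
  · intro k
    refine Continuous.aestronglyMeasurable ?_
    have := continuous_circleMap 0 r
    fun_prop
  · intro k
    refine Eventually.of_forall fun θ _ => le_of_eq ?_
    simp [abs_of_nonneg h0, mul_assoc]
  · exact Eventually.of_forall fun θ _ => (h.summable_norm h0 h1).mul_right _
  · exact intervalIntegrable_const
  · refine Eventually.of_forall fun θ _ => ?_
    have := (h _ (circleMap_mem h0 h1 θ)).mul_right (conj (circleMap 0 r θ ^ n))
    simpa only [mul_assoc] using this

lemma unique {f : ℂ → ℂ} {a b : ℕ → ℂ} (ha : HasDiscSeries f a) (hb : HasDiscSeries f b) :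
    a = b := by
  funext n
  have h := (integral_mul_monomial ha (r := 1 / 2) (by norm_num) (by norm_num) n).symm.trans
    (integral_mul_monomial hb (r := 1 / 2) (by norm_num) (by norm_num) n)
  have hpi : (Real.pi : ℂ) ≠ 0 := by exact_mod_cast Real.pi_ne_zero
  simpa [hpi] using h

/-- The mean of `g * conj f` over a circle, in terms of the coefficients. -/
lemma hasSum_circleAverage {f g : ℂ → ℂ} {a b : ℕ → ℂ} (hf : HasDiscSeries f a)
    (hg : HasDiscSeries g b) {r : ℝ} (h0 : 0 ≤ r) (h1 : r < 1) :
    HasSum (fun n => b n * conj (a n) * (r : ℂ) ^ (2 * n))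
      (Real.circleAverage (fun z => g z * conj (f z)) 0 r) := by
  have hcg := hg.continuous_circle h0 h1
  have key := intervalIntegral.hasSum_integral_of_dominated_convergence
    (μ := MeasureTheory.volume) (a := 0) (b := 2 * Real.pi)
    (F := fun n θ => conj (a n) * (g (circleMap 0 r θ) * conj (circleMap 0 r θ ^ n)))
    (f := fun θ => g (circleMap 0 r θ) * conj (f (circleMap 0 r θ)))
    (fun n _ => ‖a n‖ * r ^ n * ∑' n, ‖b n‖ * r ^ n) ?_ ?_ ?_ ?_ ?_
  · rw [Real.circleAverage_def]
    have := key.const_smul ((2 * Real.pi)⁻¹ : ℝ)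
    refine this.congr_fun ?_
    intro n
    rw [intervalIntegral.integral_const_mul, integral_mul_monomial hg h0 h1]
    have hpi : (Real.pi : ℂ) ≠ 0 := by exact_mod_cast Real.pi_ne_zero
    rw [Complex.real_smul]
    push_cast
    field_simp
  · intro n
    refine Continuous.aestronglyMeasurable ?_
    have h2 := continuous_circleMap 0 r
    exact continuous_const.mul (hcg.mul (Complex.continuous_conj.comp (h2.pow n)))
  · intro n
    refine Eventually.of_forall fun θ _ => ?_
    have := hg.norm_le h0 h1 θ
    simp only [norm_mul, RCLike.norm_conj, norm_pow, norm_circleMap_zero, abs_of_nonneg h0]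
    rw [mul_comm ‖g _‖, ← mul_assoc]
    gcongr
  · exact Eventually.of_forall fun θ _ => (hf.summable_norm h0 h1).mul_right _
  · exact intervalIntegrable_const
  · refine Eventually.of_forall fun θ _ => ?_
    have h2 := hf _ (circleMap_mem h0 h1 θ)
    have h4 := (Complex.hasSum_conj'.2 (by simpa using h2) :
      HasSum (fun n => conj (a n * circleMap 0 r θ ^ n)) (conj (f (circleMap 0 r θ))))
    have := h4.mul_left (g (circleMap 0 r θ))
    refine this.congr_fun ?_
    intro n
    simp only [map_mul]
    ring

lemma hasSum_circleAverage_sq {f : ℂ → ℂ} {a : ℕ → ℂ} (hf : HasDiscSeries f a) {r : ℝ}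
    (h0 : 0 ≤ r) (h1 : r < 1) :
    HasSum (fun n => ‖a n‖ ^ 2 * r ^ (2 * n))
      (Real.circleAverage (fun z => ‖f z‖ ^ 2) 0 r) := by
  have h := hasSum_circleAverage hf hf h0 h1
  have h2 : Real.circleAverage (fun z => f z * conj (f z)) 0 r =
      ((Real.circleAverage (fun z => ‖f z‖ ^ 2) 0 r : ℝ) : ℂ) := by
    simp only [Real.circleAverage_def, Complex.mul_conj', Complex.real_smul, smul_eq_mul]
    push_cast
    rw [← intervalIntegral.integral_ofReal]
    push_cast
    rfl
  rw [h2] at h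
  refine Complex.hasSum_ofReal.1 (h.congr_fun fun n => ?_)
  rw [Complex.mul_conj']
  push_cast
  rfl

lemma tendsto_circleAverage {f g : ℂ → ℂ} {a b : ℕ → ℂ} (hf : HasDiscSeries f a)
    (hg : HasDiscSeries g b) (ha : Summable fun n => ‖a n‖ ^ 2)
    (hb : Summable fun n => ‖b n‖ ^ 2) :
    Tendsto (fun r : ℝ => Real.circleAverage (fun z => g z * conj (f z)) 0 r) (𝓝[<] 1)
      (𝓝 (∑' n, b n * conj (a n))) := by
  have hev : ∀ᶠ r : ℝ in 𝓝[<] 1, 0 ≤ r ∧ r < 1 := by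
    filter_upwards [self_mem_nhdsWithin, mem_nhdsWithin_of_mem_nhds
      (Ici_mem_nhds (zero_lt_one (α := ℝ)))] with r h1 h0 using ⟨h0, h1⟩
  have hsum : Summable fun n => ‖a n‖ ^ 2 + ‖b n‖ ^ 2 := ha.add hb
  have hlim := tendsto_tsum_of_dominated_convergence (𝓕 := 𝓝[<] (1 : ℝ))
    (f := fun (r : ℝ) n => b n * conj (a n) * (r : ℂ) ^ (2 * n))
    (g := fun n => b n * conj (a n)) hsum ?_ ?_
  · refine hlim.congr' ?_
    filter_upwards [hev] with r hr
    exact (hasSum_circleAverage hf hg hr.1 hr.2).tsum_eq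
  · intro n
    have : Continuous fun r : ℝ => b n * conj (a n) * (r : ℂ) ^ (2 * n) := by fun_prop
    simpa using (this.tendsto 1).mono_left nhdsWithin_le_nhds
  · filter_upwards [hev] with r hr n
    rw [norm_mul, norm_mul, RCLike.norm_conj, norm_pow, Complex.norm_real, Real.norm_eq_abs,
      abs_of_nonneg hr.1]
    have h1 : r ^ (2 * n) ≤ 1 := pow_le_one₀ hr.1 hr.2.le
    have h2 : 0 ≤ ‖b n‖ * ‖a n‖ := by positivity
    nlinarith [sq_nonneg (‖a n‖ - ‖b n‖), sq_nonneg (‖a n‖ + ‖b n‖)]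

lemma tendsto_circleAverage_sq {f : ℂ → ℂ} {a : ℕ → ℂ} (hf : HasDiscSeries f a)
    (ha : Summable fun n => ‖a n‖ ^ 2) :
    Tendsto (fun r : ℝ => Real.circleAverage (fun z => ‖f z‖ ^ 2) 0 r) (𝓝[<] 1)
      (𝓝 (∑' n, ‖a n‖ ^ 2)) := by
  have hev : ∀ᶠ r : ℝ in 𝓝[<] 1, 0 ≤ r ∧ r < 1 := by
    filter_upwards [self_mem_nhdsWithin, mem_nhdsWithin_of_mem_nhds
      (Ici_mem_nhds (zero_lt_one (α := ℝ)))] with r h1 h0 using ⟨h0, h1⟩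
  have hlim := tendsto_tsum_of_dominated_convergence (𝓕 := 𝓝[<] (1 : ℝ))
    (f := fun (r : ℝ) n => ‖a n‖ ^ 2 * r ^ (2 * n))
    (g := fun n => ‖a n‖ ^ 2) ha ?_ ?_
  · refine hlim.congr' ?_
    filter_upwards [hev] with r hr
    exact (hasSum_circleAverage_sq hf hr.1 hr.2).tsum_eq
  · intro n
    have : Continuous fun r : ℝ => ‖a n‖ ^ 2 * r ^ (2 * n) := by fun_prop
    simpa using (this.tendsto 1).mono_left nhdsWithin_le_nhds
  · filter_upwards [hev] with r hr n
    rw [Real.norm_eq_abs, abs_of_nonneg (by have := hr.1; positivity)]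
    exact mul_le_of_le_one_right (by positivity) (pow_le_one₀ hr.1 hr.2.le)

lemma summable_sq {f : ℂ → ℂ} {a : ℕ → ℂ} (hf : HasDiscSeries f a) {L : ℝ}
    (hL : Tendsto (fun r : ℝ => Real.circleAverage (fun z => ‖f z‖ ^ 2) 0 r) (𝓝[<] 1) (𝓝 L)) :
    Summable fun n => ‖a n‖ ^ 2 := by
  have hev : ∀ᶠ r : ℝ in 𝓝[<] 1, 0 ≤ r ∧ r < 1 := by
    filter_upwards [self_mem_nhdsWithin, mem_nhdsWithin_of_mem_nhds
      (Ici_mem_nhds (zero_lt_one (α := ℝ)))] with r h1 h0 using ⟨h0, h1⟩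
  refine summable_of_sum_le (c := L) (fun n => by positivity) (fun u => ?_)
  have hc : Continuous fun r : ℝ => ∑ n ∈ u, ‖a n‖ ^ 2 * r ^ (2 * n) := by fun_prop
  have ht : Tendsto (fun r : ℝ => ∑ n ∈ u, ‖a n‖ ^ 2 * r ^ (2 * n)) (𝓝[<] 1)
      (𝓝 (∑ n ∈ u, ‖a n‖ ^ 2)) := by
    simpa using (hc.tendsto 1).mono_left nhdsWithin_le_nhds
  refine le_of_tendsto_of_tendsto ht hL ?_
  filter_upwards [hev] with r hr
  refine sum_le_hasSum u (fun n _ => ?_) (hasSum_circleAverage_sq hf hr.1 hr.2)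
  have := hr.1
  positivity

end HasDiscSeries

/-! ### The Hardy space -/

/-- Membership in the Hardy space `H²` of the unit disc: `f` is analytic on the open unit disc and
its integral means `(1/2π) ∫₀^{2π} |f(r e^{iθ})|² dθ` have a finite limit as `r → 1⁻`. A function
on the disc is represented by its extension by zero to `ℂ`. -/
structure MemHardy (f : ℂ → ℂ) : Prop where
  differentiableOn : DifferentiableOn ℂ f (ball 0 1)
  exists_tendsto : ∃ L : ℝ,
    Tendsto (fun r : ℝ => Real.circleAverage (fun z => ‖f z‖ ^ 2) 0 r) (𝓝[<] 1) (𝓝 L)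
  eq_zero_of_notMem : ∀ z ∉ ball (0 : ℂ) 1, f z = 0

/-- The Taylor coefficients at the origin. -/
def discCoeff (f : ℂ → ℂ) (n : ℕ) : ℂ := (n.factorial : ℂ)⁻¹ * iteratedDeriv n f 0

lemma MemHardy.hasDiscSeries {f : ℂ → ℂ} (hf : MemHardy f) : HasDiscSeries f (discCoeff f) :=
  HasDiscSeries.of_differentiableOn hf.differentiableOn

lemma MemHardy.summable {f : ℂ → ℂ} (hf : MemHardy f) : Summable fun n => ‖discCoeff f n‖ ^ 2 :=
  hf.hasDiscSeries.summable_sq hf.exists_tendsto.choose_spec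

lemma HasDiscSeries.memHardy {f : ℂ → ℂ} {a : ℕ → ℂ} (h : HasDiscSeries f a)
    (ha : Summable fun n => ‖a n‖ ^ 2) (h0 : ∀ z ∉ ball (0 : ℂ) 1, f z = 0) : MemHardy f :=
  ⟨h.differentiableOn, ⟨_, h.tendsto_circleAverage_sq ha⟩, h0⟩

lemma HasDiscSeries.discCoeff_eq {f : ℂ → ℂ} {a : ℕ → ℂ} (h : HasDiscSeries f a) :
    discCoeff f = a :=
  (HasDiscSeries.of_differentiableOn h.differentiableOn).unique h

lemma HasDiscSeries.add {f g : ℂ → ℂ} {a b : ℕ → ℂ} (hf : HasDiscSeries f a)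
    (hg : HasDiscSeries g b) : HasDiscSeries (f + g) (a + b) := fun z hz =>
  ((hf z hz).add (hg z hz)).congr_fun fun n => by simp [add_mul]

lemma HasDiscSeries.smul {f : ℂ → ℂ} {a : ℕ → ℂ} (hf : HasDiscSeries f a) (c : ℂ) :
    HasDiscSeries (c • f) (c • a) := fun z hz =>
  ((hf z hz).mul_left c).congr_fun fun n => by simp [mul_assoc]

lemma MemHardy.add {f g : ℂ → ℂ} (hf : MemHardy f) (hg : MemHardy g) : MemHardy (f + g) := by
  refine (hf.hasDiscSeries.add hg.hasDiscSeries).memHardy ?_ fun z hz => by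
    simp [hf.eq_zero_of_notMem z hz, hg.eq_zero_of_notMem z hz]
  refine Summable.of_nonneg_of_le (fun n => by positivity) (fun n => ?_)
    ((hf.summable.add hg.summable).mul_left 2)
  have h1 := norm_add_le (discCoeff f n) (discCoeff g n)
  have h2 := norm_nonneg (discCoeff f n + discCoeff g n)
  simp only [Pi.add_apply]
  nlinarith [sq_nonneg (‖discCoeff f n‖ - ‖discCoeff g n‖)]

lemma MemHardy.smul {f : ℂ → ℂ} (hf : MemHardy f) (c : ℂ) : MemHardy (c • f) := by
  refine (hf.hasDiscSeries.smul c).memHardy ?_ fun z hz => by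
    simp [hf.eq_zero_of_notMem z hz]
  simpa [mul_pow] using hf.summable.mul_left (‖c‖ ^ 2)

lemma MemHardy.zero : MemHardy 0 := by
  have h : HasDiscSeries 0 0 := fun z _ => by simp
  exact h.memHardy (by simp) (by simp)

/-- The linear subspace of functions that make up `H²`. -/
def hardySubmodule : Submodule ℂ (ℂ → ℂ) where
  carrier := {f | MemHardy f}
  add_mem' := MemHardy.add
  zero_mem' := MemHardy.zero
  smul_mem' c _ hf := hf.smul c

/-- The Hardy space `H²` of the unit disc. -/
def HardySpace : Type := hardySubmodule

namespace HardySpace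

instance : AddCommGroup HardySpace := inferInstanceAs (AddCommGroup hardySubmodule)

instance : Module ℂ HardySpace := inferInstanceAs (Module ℂ hardySubmodule)

instance : CoeFun HardySpace (fun _ => ℂ → ℂ) := ⟨fun f => f.1⟩

lemma memHardy (f : HardySpace) : MemHardy f := f.2

lemma ext_disc {f g : HardySpace} (h : ∀ z ∈ ball (0 : ℂ) 1, f z = g z) : f = g := by
  refine Subtype.ext (funext fun z => ?_)
  by_cases hz : z ∈ ball (0 : ℂ) 1
  · exact h z hz
  · exact (f.memHardy.eq_zero_of_notMem z hz).trans (g.memHardy.eq_zero_of_notMem z hz).symm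

lemma coeff_add (f g : HardySpace) : discCoeff (f + g : HardySpace) = discCoeff f + discCoeff g :=
  (f.memHardy.hasDiscSeries.add g.memHardy.hasDiscSeries).discCoeff_eq

lemma coeff_smul (c : ℂ) (f : HardySpace) : discCoeff (c • f : HardySpace) = c • discCoeff f :=
  (f.memHardy.hasDiscSeries.smul c).discCoeff_eq

/-- The inner product of `H²`, conjugate-linear in the first variable:
`⟪f, g⟫ = lim_{r → 1⁻} (1/2π) ∫₀^{2π} g(r e^{iθ}) * conj (f(r e^{iθ})) dθ`. -/
instance : Inner ℂ HardySpace where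
  inner f g :=
    limUnder (𝓝[<] (1 : ℝ)) fun r : ℝ => Real.circleAverage (fun z => g z * conj (f z)) 0 r

lemma inner_eq_tsum (f g : HardySpace) :
    inner ℂ f g = ∑' n, discCoeff g n * conj (discCoeff f n) :=
  (f.memHardy.hasDiscSeries.tendsto_circleAverage g.memHardy.hasDiscSeries f.memHardy.summable
    g.memHardy.summable).limUnder_eq

/-- The limit that defines the inner product exists. -/
lemma tendsto_inner (f g : HardySpace) :
    Tendsto (fun r : ℝ => Real.circleAverage (fun z => g z * conj (f z)) 0 r) (𝓝[<] 1)
      (𝓝 (inner ℂ f g)) := by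
  rw [inner_eq_tsum]
  exact f.memHardy.hasDiscSeries.tendsto_circleAverage g.memHardy.hasDiscSeries
    f.memHardy.summable g.memHardy.summable

lemma memlp (f : HardySpace) : Memℓp (discCoeff f) 2 :=
  (memℓp_gen_iff (by norm_num)).2 (by simpa using f.memHardy.summable)

/-- The Taylor coefficients of an element of `H²`, as an element of `ℓ²`. -/
def toL2 : HardySpace →ₗ[ℂ] lp (fun _ : ℕ => ℂ) 2 where
  toFun f := ⟨discCoeff f, f.memlp⟩
  map_add' f g := Subtype.ext (coeff_add f g)
  map_smul' c f := Subtype.ext (coeff_smul c f)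

lemma inner_toL2 (f g : HardySpace) : inner ℂ (toL2 f) (toL2 g) = inner ℂ f g := by
  rw [inner_eq_tsum, lp.inner_eq_tsum]
  rfl

lemma toL2_injective : Function.Injective toL2 := by
  intro f g h
  refine ext_disc fun z hz => ?_
  have hc : discCoeff f = discCoeff g := congrArg Subtype.val h
  have h1 := f.memHardy.hasDiscSeries z hz
  rw [hc] at h1
  exact h1.unique (g.memHardy.hasDiscSeries z hz)

lemma toL2_surjective : Function.Surjective toL2 := by
  intro a
  have ha : Summable fun n => ‖a n‖ ^ 2 := by
    simpa using (memℓp_gen_iff (by norm_num)).1 a.2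
  let F : ℂ → ℂ := (ball (0 : ℂ) 1).indicator fun z => ∑' n, a n * z ^ n
  have hF : HasDiscSeries F a := by
    intro z hz
    have hz' : ‖z‖ < 1 := by simpa using hz
    simp only [F, Set.indicator_of_mem hz]
    refine Summable.hasSum (Summable.of_norm ?_)
    have hg : Summable fun n : ℕ => (‖z‖ ^ 2) ^ n :=
      summable_geometric_of_lt_one (by positivity) (by nlinarith [norm_nonneg z])
    refine Summable.of_nonneg_of_le (fun n => norm_nonneg _) (fun n => ?_) (ha.add hg)
    rw [norm_mul, norm_pow, ← pow_mul, mul_comm 2 n, pow_mul]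
    nlinarith [sq_nonneg (‖a n‖ - ‖z‖ ^ n), sq_nonneg (‖a n‖ + ‖z‖ ^ n)]
  have hm : MemHardy F := hF.memHardy ha fun z hz => Set.indicator_of_notMem hz _
  exact ⟨⟨F, hm⟩, Subtype.ext hF.discCoeff_eq⟩

@[reducible] def core : InnerProductSpace.Core ℂ HardySpace where
  conj_inner_symm f g := by
    rw [← inner_toL2, ← inner_toL2]
    exact inner_conj_symm _ _
  re_inner_nonneg f := by
    rw [← inner_toL2]
    exact inner_self_nonneg (𝕜 := ℂ)
  add_left f g h := by
    simp only [← inner_toL2, map_add, inner_add_left]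
  smul_left f g c := by
    simp only [← inner_toL2, map_smul, inner_smul_left]
  definite f hf := by
    rw [← inner_toL2, inner_self_eq_zero] at hf
    exact toL2_injective (hf.trans (map_zero _).symm)

instance : NormedAddCommGroup HardySpace := core.toNormedAddCommGroup

instance : InnerProductSpace ℂ HardySpace := InnerProductSpace.ofCore core.toCore

/-- The norm of `H²` is the one given by the integral means. -/
lemma tendsto_norm_sq (f : HardySpace) :
    Tendsto (fun r : ℝ => Real.circleAverage (fun z => ‖f z‖ ^ 2) 0 r) (𝓝[<] 1)
      (𝓝 (‖f‖ ^ 2)) := by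
  have h : ‖f‖ ^ 2 = ∑' n, ‖discCoeff f n‖ ^ 2 := by
    have h1 := inner_self_eq_norm_sq_to_K (𝕜 := ℂ) f
    rw [inner_eq_tsum] at h1
    simp only [Complex.mul_conj'] at h1
    have h2 : ((‖f‖ ^ 2 : ℝ) : ℂ) = ((∑' n, ‖discCoeff f n‖ ^ 2 : ℝ) : ℂ) := by
      push_cast
      exact h1.symm
    exact_mod_cast h2
  rw [h]
  exact f.memHardy.hasDiscSeries.tendsto_circleAverage_sq f.memHardy.summable

/-- `H²` is isometric to `ℓ²` through the Taylor coefficients. -/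
def equivL2 : HardySpace ≃ₗᵢ[ℂ] lp (fun _ : ℕ => ℂ) 2 :=
  (LinearEquiv.ofBijective toL2 ⟨toL2_injective, toL2_surjective⟩).isometryOfInner inner_toL2

instance : CompleteSpace HardySpace :=
  equivL2.toIsometryEquiv.completeSpace_iff.2 inferInstance

lemma memHardy_conj (f : HardySpace) : MemHardy fun z => conj (f (conj z)) := by
  have h : HasDiscSeries (fun z => conj (f (conj z))) fun n => conj (discCoeff f n) := by
    intro z hz
    have hz' : conj z ∈ ball (0 : ℂ) 1 := by simpa using hz
    have h1 : HasSum (fun n => conj (discCoeff f n * conj z ^ n)) (conj (f (conj z))) :=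
      Complex.hasSum_conj'.2 (by simpa using f.memHardy.hasDiscSeries _ hz')
    refine h1.congr_fun fun n => ?_
    simp
  refine h.memHardy (by simpa using f.memHardy.summable) fun z hz => ?_
  have hz' : conj z ∉ ball (0 : ℂ) 1 := by simpa using hz
  simp [f.memHardy.eq_zero_of_notMem _ hz']

/-- The conjugation `(J f)(z) = conj (f (conj z))` on `H²`. -/
def J (f : HardySpace) : HardySpace := ⟨fun z => conj (f (conj z)), f.memHardy_conj⟩

/-- The bounded operator `T` on `H²` is the weighted composition operator `C_{ψ,φ}`:
`(T f)(z) = ψ(z) f(φ(z))` for all `f ∈ H²` and `z` in the unit disc. -/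
def IsWeightedComposition (ψ φ : ℂ → ℂ) (T : HardySpace →L[ℂ] HardySpace) : Prop :=
  ∀ f : HardySpace, ∀ z ∈ ball (0 : ℂ) 1, T f z = ψ z * f (φ z)

/-- `T` is `J`-symmetric: `J T* J = T`. -/
def IsJSymmetric (T : HardySpace →L[ℂ] HardySpace) : Prop :=
  ∀ f : HardySpace, J (ContinuousLinearMap.adjoint T (J f)) = T f

end HardySpace

end

/-! Everything is tested on the reproducing kernels `K_w(z) = 1 / (1 - conj w * z)`, which span a
dense subspace. A weighted composition operator `T` satisfies `T* K_w = conj (ψ w) • K_{φ w}`, so `T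
T* = 1` and `J T* J = T` become two functional equations for `ψ` and `φ` on the disc.

Conversely, the first equation says that `K_w ↦ conj (ψ w) • K_{φ w}` preserves inner products. It
therefore extends to an isometry, whose adjoint is the required operator `T` with `T T* = 1`. The
second equation gives `J`-symmetry, and conjugating `T T* = 1` by `J` gives `T* T = 1`. This
equivalence is `exists_unitary_isJSymmetric_iff`.

Putting one variable equal to `0` in the equations gives `ψ` from `ψ 0` and `φ 0`, and also `φ` when
`φ 0 ≠ 0`: this is the first case, with `p = conj (φ 0)`. If `φ 0 = 0`, then `ψ` is constant and `φ`
is a rotation. -/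

/-- A correspondence between two families of vectors that preserves all inner products extends to
a linear isometry, if the first family spans a dense subspace. -/
theorem exists_isometry_of_inner_eq {ι E F : Type*} [NormedAddCommGroup E] [InnerProductSpace ℂ E]
    [NormedAddCommGroup F] [InnerProductSpace ℂ F] [CompleteSpace F] (u : ι → E) (v : ι → F)
    (hu : Dense (Submodule.span ℂ (Set.range u) : Set E))
    (h : ∀ i j, inner ℂ (v i) (v j) = inner ℂ (u i) (u j)) :
    ∃ S : E →L[ℂ] F, (∀ i, S (u i) = v i) ∧ ∀ x, ‖S x‖ = ‖x‖ := by
  -- A squared norm expands into Gram entries only. Equality of norms makes the map well defined on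
  -- the span even when the `u i` are linearly dependent.
  have hnorm : ∀ x : ι →₀ ℂ, ‖Finsupp.linearCombination ℂ v x‖ =
      ‖Finsupp.linearCombination ℂ u x‖ := by
    intro x
    have : inner ℂ (Finsupp.linearCombination ℂ v x) (Finsupp.linearCombination ℂ v x) =
        inner ℂ (Finsupp.linearCombination ℂ u x) (Finsupp.linearCombination ℂ u x) := by
      simp only [Finsupp.linearCombination_apply, Finsupp.sum, sum_inner, inner_sum,
        inner_smul_left, inner_smul_right, h]
    rw [@norm_eq_sqrt_re_inner ℂ, @norm_eq_sqrt_re_inner ℂ, this]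
  have hdense : DenseRange (Finsupp.linearCombination ℂ u) := by
    rwa [DenseRange, ← LinearMap.coe_range, Finsupp.range_linearCombination]
  have heq := LinearMap.extendOfNorm_eq (f := Finsupp.linearCombination ℂ v) hdense
    ⟨1, fun x => by rw [one_mul, hnorm]⟩
  refine ⟨(Finsupp.linearCombination ℂ v).extendOfNorm (Finsupp.linearCombination ℂ u),
    fun i => by simpa using heq (Finsupp.single i 1), fun x => ?_⟩
  refine hdense.induction_on (p := fun x => ‖LinearMap.extendOfNorm
    (Finsupp.linearCombination ℂ v) (Finsupp.linearCombination ℂ u) x‖ = ‖x‖) x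
    (isClosed_eq (by fun_prop) (by fun_prop)) fun y => ?_
  rw [heq, hnorm]

/-! ### Reproducing kernels of `H²` -/

namespace HardySpace

lemma one_sub_mul_ne_zero {w z : ℂ} (hw : w ∈ ball (0 : ℂ) 1) (hz : z ∈ ball (0 : ℂ) 1) :
    1 - w * z ≠ 0 := by
  intro h
  have h1 : ‖w * z‖ = 1 := by rw [← sub_eq_zero.1 h, norm_one]
  rw [mem_ball_zero_iff] at hw hz
  rw [norm_mul] at h1
  nlinarith [norm_nonneg w, norm_nonneg z]

lemma conj_mem_ball {w : ℂ} (hw : w ∈ ball (0 : ℂ) 1) : conj w ∈ ball (0 : ℂ) 1 := by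
  simpa using hw

lemma exists_kernel {w : ℂ} (hw : w ∈ ball (0 : ℂ) 1) :
    ∃ k : HardySpace, discCoeff k = (fun n => conj w ^ n) ∧
      ∀ z ∈ ball (0 : ℂ) 1, k z = (1 - conj w * z)⁻¹ := by
  have hF : HasDiscSeries ((ball (0 : ℂ) 1).indicator fun z => (1 - conj w * z)⁻¹)
      (fun n => conj w ^ n) := by
    intro z hz
    rw [Set.indicator_of_mem hz]
    simp only [← mul_pow]
    refine hasSum_geometric_of_norm_lt_one ?_
    rw [mem_ball_zero_iff] at hw hz
    rw [norm_mul, RCLike.norm_conj]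
    nlinarith [norm_nonneg w, norm_nonneg z]
  have hs : Summable fun n : ℕ => ‖conj w ^ n‖ ^ 2 := by
    have : ∀ n : ℕ, ‖conj w ^ n‖ ^ 2 = (‖w‖ ^ 2) ^ n := fun n => by
      rw [norm_pow, RCLike.norm_conj, ← pow_mul, ← pow_mul, mul_comm]
    simp only [this]
    rw [mem_ball_zero_iff] at hw
    exact summable_geometric_of_lt_one (by positivity) (by nlinarith [norm_nonneg w])
  exact ⟨⟨_, hF.memHardy hs fun z hz => Set.indicator_of_notMem hz _⟩, hF.discCoeff_eq,
    fun z hz => Set.indicator_of_mem hz fun z => (1 - conj w * z)⁻¹⟩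

/-- The reproducing kernel `K_w(z) = 1 / (1 - conj w * z)` of `H²`. -/
noncomputable def kernel (w : ball (0 : ℂ) 1) : HardySpace := (exists_kernel w.2).choose

lemma kernel_apply (w : ball (0 : ℂ) 1) {z : ℂ} (hz : z ∈ ball (0 : ℂ) 1) :
    kernel w z = (1 - conj (w : ℂ) * z)⁻¹ :=
  (exists_kernel w.2).choose_spec.2 z hz

/-- Pairing with the coefficients `conj w ^ n` sums the Taylor series of `f` at `w`. -/
lemma inner_kernel (w : ball (0 : ℂ) 1) (f : HardySpace) : inner ℂ (kernel w) f = f w := by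
  rw [inner_eq_tsum, kernel, (exists_kernel w.2).choose_spec.1]
  simpa using (f.memHardy.hasDiscSeries w w.2).tsum_eq

lemma eq_of_inner_kernel {f g : HardySpace}
    (h : ∀ w, inner ℂ (kernel w) f = inner ℂ (kernel w) g) : f = g :=
  ext_disc fun z hz => by simpa [inner_kernel] using h ⟨z, hz⟩

/-- A function orthogonal to every kernel vanishes at every point of the disc. -/
lemma dense_span_kernel : Dense (Submodule.span ℂ (Set.range kernel) : Set HardySpace) := by
  rw [Submodule.dense_iff_topologicalClosure_eq_top, Submodule.topologicalClosure_eq_top_iff,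
    Submodule.eq_bot_iff]
  intro f hf
  refine eq_of_inner_kernel fun w => ?_
  rw [inner_zero_right]
  exact (Submodule.mem_orthogonal _ _).1 hf _ (Submodule.subset_span ⟨w, rfl⟩)

lemma J_apply (f : HardySpace) (z : ℂ) : J f z = conj (f (conj z)) := rfl

lemma J_J (f : HardySpace) : J (J f) = f :=
  ext_disc fun z _ => by simp [J_apply]

lemma smul_apply (c : ℂ) (f : HardySpace) (z : ℂ) : (c • f) z = c * f z := rfl

/-! ### Functional equations for the weight and the symbol -/

lemma IsWeightedComposition.adjoint_kernel {ψ φ : ℂ → ℂ} {T : HardySpace →L[ℂ] HardySpace}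
    (hT : IsWeightedComposition ψ φ T) (w : ball (0 : ℂ) 1) (hw : φ w ∈ ball (0 : ℂ) 1) :
    ContinuousLinearMap.adjoint T (kernel w) = conj (ψ w) • kernel ⟨φ w, hw⟩ := by
  refine ext_inner_right ℂ fun f => ?_
  rw [ContinuousLinearMap.adjoint_inner_left, inner_kernel, hT f w w.2, inner_smul_left,
    inner_kernel, Complex.conj_conj]

/-- This is `T T* K_w = K_w` evaluated at `z`, with denominators cleared. -/
lemma IsWeightedComposition.mul_conj_eq {ψ φ : ℂ → ℂ}
    (hmaps : Set.MapsTo φ (ball 0 1) (ball 0 1)) {T : HardySpace →L[ℂ] HardySpace}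
    (hT : IsWeightedComposition ψ φ T) (hU : T * star T = 1) {z w : ℂ} (hz : z ∈ ball (0 : ℂ) 1)
    (hw : w ∈ ball (0 : ℂ) 1) :
    ψ z * conj (ψ w) * (1 - conj w * z) = 1 - conj (φ w) * φ z := by
  have h := congrArg (fun A : HardySpace →L[ℂ] HardySpace => A (kernel ⟨w, hw⟩) z) hU
  have h' : T (ContinuousLinearMap.adjoint T (kernel ⟨w, hw⟩)) z = kernel ⟨w, hw⟩ z := h
  rw [hT.adjoint_kernel ⟨w, hw⟩ (hmaps hw), hT _ z hz, smul_apply,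
    kernel_apply _ (hmaps hz), kernel_apply _ hz] at h'
  have h1 := one_sub_mul_ne_zero (conj_mem_ball hw) hz
  have h2 := one_sub_mul_ne_zero (conj_mem_ball (hmaps hw)) (hmaps hz)
  field_simp at h'
  linear_combination h'

/-- `J`-symmetry is applied to `K_{conj u}`. Since `J` turns this kernel into `K_u`, the
conjugations cancel. -/
lemma IsWeightedComposition.mul_eq_mul {ψ φ : ℂ → ℂ}
    (hmaps : Set.MapsTo φ (ball 0 1) (ball 0 1)) {T : HardySpace →L[ℂ] HardySpace}
    (hT : IsWeightedComposition ψ φ T) (hJ : IsJSymmetric T) {z u : ℂ} (hz : z ∈ ball (0 : ℂ) 1)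
    (hu : u ∈ ball (0 : ℂ) 1) :
    ψ u * (1 - u * φ z) = ψ z * (1 - φ u * z) := by
  have hu' := conj_mem_ball hu
  have hk : J (kernel ⟨conj u, hu'⟩) = kernel ⟨u, hu⟩ := ext_disc fun x hx => by
    rw [J_apply, kernel_apply _ (conj_mem_ball hx), kernel_apply _ hx]
    simp
  have h : J (ContinuousLinearMap.adjoint T (J (kernel ⟨conj u, hu'⟩))) z =
    T (kernel ⟨conj u, hu'⟩) z := by rw [hJ]
  rw [hk, hT.adjoint_kernel ⟨u, hu⟩ (hmaps hu), hT _ z hz, J_apply, smul_apply,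
    kernel_apply _ (hmaps hz), kernel_apply _ (conj_mem_ball hz)] at h
  simp only [map_mul, map_inv₀, map_sub, map_one, Complex.conj_conj] at h
  have h1 := one_sub_mul_ne_zero hu (hmaps hz)
  have h2 := one_sub_mul_ne_zero (hmaps hu) hz
  field_simp at h
  linear_combination h

/-- The hypothesis is equivalent to `T K_{conj z} = ψ z • K_{conj (φ z)}`; pairing this with `J f`
yields the claim for every `f`, without a density argument. -/
lemma IsWeightedComposition.isJSymmetric {ψ φ : ℂ → ℂ}
    (hmaps : Set.MapsTo φ (ball 0 1) (ball 0 1)) {T : HardySpace →L[ℂ] HardySpace}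
    (hT : IsWeightedComposition ψ φ T)
    (h : ∀ z ∈ ball (0 : ℂ) 1, ∀ u ∈ ball (0 : ℂ) 1,
      ψ u * (1 - u * φ z) = ψ z * (1 - φ u * z)) : IsJSymmetric T := by
  intro f
  refine ext_disc fun z hz => ?_
  have hz' := conj_mem_ball hz
  have hk : T (kernel ⟨conj z, hz'⟩) = ψ z • kernel ⟨conj (φ z), conj_mem_ball (hmaps hz)⟩ := by
    refine ext_disc fun x hx => ?_
    rw [hT _ x hx, smul_apply, kernel_apply _ hx, kernel_apply _ (hmaps hx)]
    simp only [Complex.conj_conj]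
    have h1 := one_sub_mul_ne_zero hz (hmaps hx)
    have h2 := one_sub_mul_ne_zero (hmaps hz) hx
    have := h x hx z hz
    field_simp
    linear_combination -this
  rw [hT f z hz, J_apply, ← inner_kernel ⟨conj z, hz'⟩, ContinuousLinearMap.adjoint_inner_right,
    hk, inner_smul_left, inner_kernel, J_apply]
  simp

/-- Since `T* = J T J` and `T = J T* J`, the product `T* T` equals `J (T T*) J = 1`. -/
lemma IsJSymmetric.mem_unitary {T : HardySpace →L[ℂ] HardySpace} (hJ : IsJSymmetric T)
    (hU : T * star T = 1) : T ∈ unitary (HardySpace →L[ℂ] HardySpace) := by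
  refine Unitary.mem_iff.2 ⟨?_, hU⟩
  have hadj : ∀ f, star T f = J (T (J f)) := fun f => by
    rw [← hJ (J f), J_J, J_J]
    rfl
  ext1 f
  have h1 : T (star T (J f)) = J f := congrArg (fun A : HardySpace →L[ℂ] HardySpace => A (J f)) hU
  change star T (T f) = f
  rw [hadj, ← hJ f, J_J]
  exact (congrArg J h1).trans (J_J f)

theorem exists_unitary_isJSymmetric_iff {ψ φ : ℂ → ℂ}
    (hmaps : Set.MapsTo φ (ball 0 1) (ball 0 1)) :
    (∃ T : HardySpace →L[ℂ] HardySpace, IsWeightedComposition ψ φ T ∧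
        T ∈ unitary (HardySpace →L[ℂ] HardySpace) ∧ IsJSymmetric T) ↔
      ∀ z ∈ ball (0 : ℂ) 1, ∀ w ∈ ball (0 : ℂ) 1,
        ψ z * conj (ψ w) * (1 - conj w * z) = 1 - conj (φ w) * φ z ∧
        ψ w * (1 - w * φ z) = ψ z * (1 - φ w * z) := by
  constructor
  · rintro ⟨T, hT, hU, hJ⟩ z hz w hw
    exact ⟨hT.mul_conj_eq hmaps (Unitary.mem_iff.1 hU).2 hz hw, hT.mul_eq_mul hmaps hJ hz hw⟩
  · intro h
    -- `S` is the prospective adjoint of `T`; the first equation is the equality of the two Gram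
    -- matrices.
    obtain ⟨S, hS, hiso⟩ := exists_isometry_of_inner_eq kernel
      (fun w => conj (ψ w) • kernel ⟨φ w, hmaps w.2⟩) dense_span_kernel fun w z => by
        rw [inner_smul_left, inner_smul_right, inner_kernel, inner_kernel,
          kernel_apply _ w.2, kernel_apply _ (hmaps w.2), Complex.conj_conj]
        have h1 := one_sub_mul_ne_zero (conj_mem_ball z.2) w.2
        have h2 := one_sub_mul_ne_zero (conj_mem_ball (hmaps z.2)) (hmaps w.2)
        have := (h w w.2 z z.2).1
        field_simp
        linear_combination this
    have hT : IsWeightedComposition ψ φ (star S) := by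
      intro f z hz
      rw [← inner_kernel ⟨z, hz⟩, ContinuousLinearMap.star_eq_adjoint,
        ContinuousLinearMap.adjoint_inner_right, hS, inner_smul_left, inner_kernel,
        Complex.conj_conj]
    have hJ := hT.isJSymmetric hmaps fun z hz u hu => (h z hz u hu).2
    refine ⟨star S, hT, hJ.mem_unitary ?_, hJ⟩
    rw [star_star]
    exact (ContinuousLinearMap.norm_map_iff_adjoint_comp_self S).1 hiso

end HardySpace

/-! ### Solving the functional equations -/

theorem proposition2p1 (ψ φ : ℂ → ℂ)
    (hψ : DifferentiableOn ℂ ψ (Metric.ball 0 1))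
    (hφ : DifferentiableOn ℂ φ (Metric.ball 0 1))
    (hmaps : Set.MapsTo φ (Metric.ball 0 1) (Metric.ball 0 1)) :
    (∃ T : HardySpace →L[ℂ] HardySpace,
        HardySpace.IsWeightedComposition ψ φ T ∧
        T ∈ unitary (HardySpace →L[ℂ] HardySpace) ∧
        HardySpace.IsJSymmetric T) ↔
      (∃ p c : ℂ, p ∈ Metric.ball (0 : ℂ) 1 ∧ p ≠ 0 ∧ ‖c‖ = 1 ∧
          ∀ z ∈ Metric.ball (0 : ℂ) 1,
            ψ z = c * (Real.sqrt (1 - ‖p‖ ^ 2) : ℂ) / (1 - conj p * z) ∧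
            φ z = conj p / p * ((p - z) / (1 - conj p * z))) ∨
      (∃ μ l : ℂ, ‖μ‖ = 1 ∧ ‖l‖ = 1 ∧
          ∀ z ∈ Metric.ball (0 : ℂ) 1, ψ z = μ ∧ φ z = l * z) := by
  rw [HardySpace.exists_unitary_isJSymmetric_iff hmaps]
  have hmul : ∀ x : ℂ, x * conj x = (‖x‖ : ℂ) ^ 2 := Complex.mul_conj'
  have h0 : (0 : ℂ) ∈ ball (0 : ℂ) 1 := by simp
  constructor
  · intro h
    have hψ0 : ψ 0 * conj (ψ 0) = 1 - conj (φ 0) * φ 0 := by simpa using (h 0 h0 0 h0).1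
    have hA : ∀ z ∈ ball (0 : ℂ) 1, ψ z * conj (ψ 0) = 1 - conj (φ 0) * φ z := fun z hz => by
      simpa using (h z hz 0 h0).1
    have hB : ∀ z ∈ ball (0 : ℂ) 1, ψ 0 = ψ z * (1 - φ 0 * z) := fun z hz => by
      simpa using (h z hz 0 h0).2
    have hnorm : ‖ψ 0‖ ^ 2 = 1 - ‖φ 0‖ ^ 2 := by
      rw [mul_comm (conj (φ 0)), hmul, hmul] at hψ0
      exact_mod_cast hψ0
    by_cases ha : φ 0 = 0
    · right
      have hψc : ∀ z ∈ ball (0 : ℂ) 1, ψ z = ψ 0 := fun z hz => by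
        simpa [ha] using (hB z hz).symm
      have hμ : ‖ψ 0‖ = 1 := by
        rw [ha, norm_zero] at hnorm
        nlinarith [norm_nonneg (ψ 0)]
      have hμ0 : ψ 0 ≠ 0 := norm_ne_zero_iff.1 (by rw [hμ]; norm_num)
      -- With `φ 0 = 0` the point `0` says nothing more about `φ`, so a nonzero test point is
      -- needed. At `1 / 2` the second equation makes `φ` linear with slope `2 * φ (1 / 2)`, and the
      -- first gives that slope modulus one.
      have hhalf : (1 / 2 : ℂ) ∈ ball (0 : ℂ) 1 := by
        rw [mem_ball_zero_iff]; norm_num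
      have hlin : ∀ z ∈ ball (0 : ℂ) 1, φ z = 2 * φ (1 / 2) * z := fun z hz => by
        have := (h z hz _ hhalf).2
        rw [hψc z hz, hψc _ hhalf] at this
        linear_combination (-2) * mul_left_cancel₀ hμ0 this
      refine ⟨ψ 0, 2 * φ (1 / 2), hμ, ?_, fun z hz => ⟨hψc z hz, hlin z hz⟩⟩
      have := (h _ hhalf _ hhalf).1
      rw [hψc _ hhalf, hmul, hμ, mul_comm (conj (φ (1 / 2))), hmul] at this
      have h4 : (‖φ (1 / 2)‖ : ℂ) ^ 2 = 1 / 4 := by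
        simp only [map_div₀, map_one, map_ofNat] at this
        push_cast at this
        linear_combination this
      have h5 : ‖φ (1 / 2)‖ ^ 2 = 1 / 4 := by
        have : ((‖φ (1 / 2)‖ ^ 2 : ℝ) : ℂ) = ((1 / 4 : ℝ) : ℂ) := by push_cast; exact h4
        exact_mod_cast this
      rw [norm_mul, Complex.norm_ofNat]
      nlinarith [norm_nonneg (φ (1 / 2))]
    · left
      have hlt : ‖φ 0‖ < 1 := by simpa using hmaps h0
      have hpos : 0 < 1 - ‖φ 0‖ ^ 2 := by nlinarith [norm_nonneg (φ 0)]
      have hs : (Real.sqrt (1 - ‖φ 0‖ ^ 2) : ℂ) ≠ 0 := by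
        exact_mod_cast (Real.sqrt_pos.2 hpos).ne'
      have hca : conj (φ 0) ≠ 0 := by simpa using ha
      -- The witnesses are read off at `z = 0`, where the target formulas give `φ 0 = conj p` and `ψ
      -- 0 = c * √(1 - ‖p‖ ^ 2)`.
      refine ⟨conj (φ 0), ψ 0 / Real.sqrt (1 - ‖φ 0‖ ^ 2), HardySpace.conj_mem_ball (hmaps h0),
        hca, ?_, fun z hz => ?_⟩
      · rw [norm_div, Complex.norm_real, Real.norm_eq_abs, abs_of_nonneg (Real.sqrt_nonneg _),
          ← hnorm, Real.sqrt_sq (norm_nonneg _), div_self]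
        intro h
        rw [h] at hnorm
        norm_num at hnorm
        linarith
      · have hne := HardySpace.one_sub_mul_ne_zero (hmaps h0) hz
        rw [Complex.conj_conj, RCLike.norm_conj]
        constructor
        · rw [div_mul_cancel₀ _ hs, eq_div_iff hne]
          exact (hB z hz).symm
        -- Eliminating `ψ z` gives `(1 - φ 0 * z) * (1 - conj (φ 0) * φ z) = 1 - ‖φ 0‖ ^ 2`, which
        -- is solved for `φ z`.
        · have h1 := hA z hz
          have h2 := hB z hz
          field_simp
          linear_combination (1 - φ 0 * z) * h1 + conj (ψ 0) * h2 - hψ0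
  · rintro (⟨p, c, hp, hp0, hc, h⟩ | ⟨μ, l, hμ, hl, h⟩) z hz w hw
    · have hlt : ‖p‖ < 1 := by simpa using hp
      have hpos : 0 ≤ 1 - ‖p‖ ^ 2 := by nlinarith [norm_nonneg p]
      have hs : (Real.sqrt (1 - ‖p‖ ^ 2) : ℂ) * Real.sqrt (1 - ‖p‖ ^ 2) = 1 - p * conj p := by
        rw [hmul]
        exact_mod_cast Real.mul_self_sqrt hpos
      have hcc : c * conj c = 1 := by rw [hmul, hc]; norm_num
      have hcp : conj p ≠ 0 := by simpa using hp0
      have h1 := HardySpace.one_sub_mul_ne_zero (HardySpace.conj_mem_ball hp) hz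
      have h2 := HardySpace.one_sub_mul_ne_zero (HardySpace.conj_mem_ball hp) hw
      have h3 := HardySpace.one_sub_mul_ne_zero hp (HardySpace.conj_mem_ball hw)
      rw [(h z hz).1, (h z hz).2, (h w hw).1, (h w hw).2]
      simp only [map_mul, map_div₀, map_sub, map_one, Complex.conj_conj, Complex.conj_ofReal]
      generalize (Real.sqrt (1 - ‖p‖ ^ 2) : ℂ) = s at hs ⊢
      constructor
      · field_simp
        linear_combination (s * s * (1 - z * conj w)) * hcc + (1 - z * conj w) * hs
      -- The factor `conj p / p` in `φ` makes `(1 - conj p * z) * (1 - w * φ z)` symmetric in `z`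
      -- and `w`.
      · field_simp
        ring
    · rw [(h z hz).1, (h z hz).2, (h w hw).1, (h w hw).2, hmul, hμ, map_mul]
      have hll : l * conj l = 1 := by rw [hmul, hl]; norm_num
      constructor
      · push_cast
        linear_combination (conj w * z) * hll
      · ring
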